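/- Let $M$ and $N$ be smooth manifolds (Hausdorff, second countable, without boundary) of the same dimension $n$. A density on $M$ is a continuous section of the density bundle of $M$: at each $p\in M$ it is a function $\mu_p:(T_pM)^n\to\mathbb{R}$ with $\mu_p(Tv_1,\dots,Tv_n)=|\det T|\,\mu_p(v_1,\dots,v_n)$ for every linear map $T:T_pM\to T_pM$, and in local coordinates $\mu=g\,|dx_1\wedge\cdots\wedge dx_n|$ with $g$ continuous; it is smooth if these coefficients $g$ are smooth. It is nonnegative if all values of every $\mu_p$ are $\ge 0$, and positive if $\mu_p(v_1,\dots,v_n)>0$ whenever $v_1,\dots,v_n$ are linearly independent. For a nonnegative density $\mu$ on $M$ let $\tilde\mu$ be the Radon measure induced by $\mu$, that is, the unique Radon measure with $\int_M f\,d\tilde\mu=\int_M f\mu$ for all $f\in C_c(M)$ (Riesz representation theorem). Let $\mu_M$ be a smooth nonnegative density on $M$, let $\mu_N$ be a smooth positive density on $N$, and let $F:M\to N$ be a ($C^\infty$) diffeomorphism. Let $(F^{-1})^*\mu_M$ be the pullback density on $N$, $$\big((F^{-1})^*\mu_M\big)_q(v_1,\dots,v_n)=(\mu_M)_{F^{-1}(q)}\big(d(F^{-1})_q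 v_1,\dots,d(F^{-1})_q v_n\big).$$ Then the pushforward measure $F_\#\tilde\mu_M$, defined by $F_\#\tilde\mu_M(E)=\tilde\mu_M(F^{-1}(E))$ for Borel sets $E\subseteq N$, satisfies $$F_\#\tilde\mu_M=\widetilde{(F^{-1})^*\mu_M}.$$ Moreover $F_\#\tilde\mu_M\ll\tilde\mu_N$, and there is a nonnegative function $f\in C^\infty(N)$ such that $F_\#\tilde\mu_M=f\,\tilde\mu_N$, that is, $F_\#\tilde\mu_M(E)=\int_E f\,d\tilde\mu_N$ for every Borel set $E\subseteq N$. -/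

import Mathlib

open Set Function MeasureTheory
open scoped Manifold ContDiff Topology

noncomputable section

/-- A density on a vector space `V` of dimension `n`: a function `μ` of `n` vectors with
`μ (T v₁, …, T vₙ) = |det T| * μ (v₁, …, vₙ)` for every linear map `T : V → V`. -/
structure VectorDensity (n : ℕ) (V : Type*) [AddCommGroup V] [Module ℝ V] where
  toFun : (Fin n → V) → ℝ
  map_linear' : ∀ (T : V →ₗ[ℝ] V) (v : Fin n → V),
    toFun (fun i => T (v i)) = |LinearMap.det T| * toFun v

namespace VectorDensity

instance (n : ℕ) (V : Type*) [AddCommGroup V] [Module ℝ V] :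
    CoeFun (VectorDensity n V) (fun _ => (Fin n → V) → ℝ) := ⟨toFun⟩

/-- A density is positive if it is positive on linearly independent `n`-tuples. -/
def IsPositive {n : ℕ} {V : Type*} [AddCommGroup V] [Module ℝ V] (δ : VectorDensity n V) : Prop :=
  ∀ v : Fin n → V, LinearIndependent ℝ v → 0 < δ v

/-- A density is nonnegative if it takes nonnegative values. -/
def IsNonneg {n : ℕ} {V : Type*} [AddCommGroup V] [Module ℝ V] (δ : VectorDensity n V) : Prop :=
  ∀ v : Fin n → V, 0 ≤ δ v

theorem map_comp_linear {n : ℕ} {V W : Type*} [AddCommGroup V] [Module ℝ V] [FiniteDimensional ℝ V]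
    [AddCommGroup W] [Module ℝ W] [FiniteDimensional ℝ W] (hV : Module.finrank ℝ V = n)
    (hW : Module.finrank ℝ W = n) (δ : VectorDensity n W) (A : V →ₗ[ℝ] W) (T : V →ₗ[ℝ] V)
    (v : Fin n → V) : δ (fun i => A (T (v i))) = |LinearMap.det T| * δ (fun i => A (v i)) := by
  let L : W ≃ₗ[ℝ] V := LinearEquiv.ofFinrankEq W V (hW.trans hV.symm)
  let b : Module.Basis (Fin n) ℝ V := Module.finBasisOfFinrankEq ℝ V hV
  let B : V →ₗ[ℝ] V := b.constr ℝ v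
  let c : Fin n → W := fun i => L.symm (b i)
  have hB : ∀ i, B (L (c i)) = v i := fun i => by simp [B, c, b.constr_basis]
  have h1 := δ.map_linear' (A ∘ₗ T ∘ₗ B ∘ₗ L.toLinearMap) c
  have h2 := δ.map_linear' (A ∘ₗ B ∘ₗ L.toLinearMap) c
  have e1 : LinearMap.det (A ∘ₗ T ∘ₗ B ∘ₗ L.toLinearMap)
      = LinearMap.det T * LinearMap.det (A ∘ₗ B ∘ₗ L.toLinearMap) := by
    have k1 : A ∘ₗ T ∘ₗ B ∘ₗ L.toLinearMap = (A ∘ₗ L.toLinearMap) ∘ₗ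
        (L.symm.toLinearMap ∘ₗ T ∘ₗ L.symm.symm.toLinearMap) ∘ₗ
        (L.symm.toLinearMap ∘ₗ B ∘ₗ L.symm.symm.toLinearMap) := by
      ext x; simp
    have k2 : A ∘ₗ B ∘ₗ L.toLinearMap = (A ∘ₗ L.toLinearMap) ∘ₗ
        (L.symm.toLinearMap ∘ₗ B ∘ₗ L.symm.symm.toLinearMap) := by
      ext x; simp
    rw [k1, k2, LinearMap.det_comp, LinearMap.det_comp, LinearMap.det_comp, LinearMap.det_conj,
      LinearMap.det_conj]
    ring
  simp only [LinearMap.comp_apply, LinearEquiv.coe_coe, hB] at h1 h2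
  rw [h1, h2, e1, abs_mul, mul_assoc]

theorem IsPositive.isNonneg {n : ℕ} {V : Type*} [AddCommGroup V] [Module ℝ V]
    [FiniteDimensional ℝ V] (hV : Module.finrank ℝ V = n) {δ : VectorDensity n V}
    (h : δ.IsPositive) : δ.IsNonneg := by
  intro v
  let b : Module.Basis (Fin n) ℝ V := Module.finBasisOfFinrankEq ℝ V hV
  have h1 := δ.map_linear' (b.constr ℝ v) b
  simp only [b.constr_basis] at h1
  rw [h1]
  exact mul_nonneg (abs_nonneg _) (h _ b.linearIndependent).le

end VectorDensity

/-- The coordinate expression in a chart `e` of a family of densities on the tangent spaces: the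
function `g` on `e.target ⊆ ℝⁿ` with `(e⁻¹)^* μ = g |dx₁ ∧ ⋯ ∧ dxₙ|`, that is, the value of `μ` on
the coordinate frame of `e`. -/
def densityCoeff {n : ℕ} {M : Type*} [TopologicalSpace M]
    [ChartedSpace (EuclideanSpace ℝ (Fin n)) M]
    (μ : ∀ p : M, VectorDensity n (TangentSpace (𝓡 n) p))
    (e : OpenPartialHomeomorph M (EuclideanSpace ℝ (Fin n))) (y : EuclideanSpace ℝ (Fin n)) : ℝ :=
  μ (e.symm y) (fun i => mfderiv (𝓡 n) (𝓡 n) e.symm y (EuclideanSpace.single i (1 : ℝ)))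

/-- A density on an `n`-manifold `M`: a continuous section of the density bundle. Continuity is
expressed in local coordinates: the coordinate expression is continuous in every smooth chart. -/
structure ManifoldDensity (n : ℕ) (M : Type*) [TopologicalSpace M]
    [ChartedSpace (EuclideanSpace ℝ (Fin n)) M] where
  toFun : ∀ p : M, VectorDensity n (TangentSpace (𝓡 n) p)
  continuousOn_coeff' : ∀ e ∈ IsManifold.maximalAtlas (𝓡 n) ∞ M,
    ContinuousOn (densityCoeff toFun e) e.target

namespace ManifoldDensity

section basic

variable {n : ℕ} {M : Type*} [TopologicalSpace M] [ChartedSpace (EuclideanSpace ℝ (Fin n)) M]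

/-- The coordinate expression of a density in a chart. -/
def coeff (μ : ManifoldDensity n M) (e : OpenPartialHomeomorph M (EuclideanSpace ℝ (Fin n))) :
    EuclideanSpace ℝ (Fin n) → ℝ :=
  densityCoeff μ.toFun e

/-- A smooth density: its coordinate expression is smooth in every smooth chart. -/
def IsSmooth (μ : ManifoldDensity n M) : Prop :=
  ∀ e ∈ IsManifold.maximalAtlas (𝓡 n) ∞ M, ContDiffOn ℝ ∞ (μ.coeff e) e.target

/-- A density is positive if it is positive on every tangent space. -/
def IsPositive (μ : ManifoldDensity n M) : Prop := ∀ p, (μ.toFun p).IsPositive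

/-- A density is nonnegative if it is nonnegative on every tangent space. -/
def IsNonneg (μ : ManifoldDensity n M) : Prop := ∀ p, (μ.toFun p).IsNonneg

theorem finrank_tangentSpace (p : M) : Module.finrank ℝ (TangentSpace (𝓡 n) p) = n := by
  change Module.finrank ℝ (EuclideanSpace ℝ (Fin n)) = n
  simp

theorem finiteDimensional_tangentSpace (p : M) :
    FiniteDimensional ℝ (TangentSpace (𝓡 n) p) :=
  inferInstanceAs (FiniteDimensional ℝ (EuclideanSpace ℝ (Fin n)))

theorem IsPositive.isNonneg {μ : ManifoldDensity n M} (h : μ.IsPositive) : μ.IsNonneg := fun p =>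
  haveI := finiteDimensional_tangentSpace (n := n) p
  (h p).isNonneg (finrank_tangentSpace p)

/-- The density `f μ`, for a continuous function `f`. -/
def mulFun (f : C(M, ℝ)) (μ : ManifoldDensity n M) : ManifoldDensity n M where
  toFun p :=
    { toFun := fun v => f p * μ.toFun p v
      map_linear' := fun T v => by rw [(μ.toFun p).map_linear']; ring }
  continuousOn_coeff' e he :=
    (f.continuous.comp_continuousOn e.continuousOn_symm).mul (μ.continuousOn_coeff' e he)

theorem coeff_mulFun (f : C(M, ℝ)) (μ : ManifoldDensity n M)
    (e : OpenPartialHomeomorph M (EuclideanSpace ℝ (Fin n))) (y : EuclideanSpace ℝ (Fin n)) :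
    (mulFun f μ).coeff e y = f (e.symm y) * μ.coeff e y := rfl

theorem continuousOn_coeff (μ : ManifoldDensity n M)
    {e : OpenPartialHomeomorph M (EuclideanSpace ℝ (Fin n))}
    (he : e ∈ IsManifold.maximalAtlas (𝓡 n) ∞ M) : ContinuousOn (μ.coeff e) e.target :=
  μ.continuousOn_coeff' e he

end basic

section pullback

variable {n : ℕ} {M N : Type*} [TopologicalSpace M] [ChartedSpace (EuclideanSpace ℝ (Fin n)) M]
  [TopologicalSpace N] [ChartedSpace (EuclideanSpace ℝ (Fin n)) N]

/-- The family `(F^* μ)_p (v₁, …, vₙ) = μ_{F p} (dF_p v₁, …, dF_p vₙ)`. -/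
def pullbackFun (μ : ∀ q : N, VectorDensity n (TangentSpace (𝓡 n) q)) (F : M → N) (p : M) :
    VectorDensity n (TangentSpace (𝓡 n) p) where
  toFun v := μ (F p) (fun i => mfderiv (𝓡 n) (𝓡 n) F p (v i))
  map_linear' T v :=
    haveI := finiteDimensional_tangentSpace (n := n) p
    haveI := finiteDimensional_tangentSpace (n := n) (F p)
    (μ (F p)).map_comp_linear (finrank_tangentSpace p) (finrank_tangentSpace (F p))
      (mfderiv (𝓡 n) (𝓡 n) F p).toLinearMap T v

theorem densityCoeff_pullbackFun [IsManifold (𝓡 n) ∞ M] [IsManifold (𝓡 n) ∞ N]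
    (μ : ∀ q : N, VectorDensity n (TangentSpace (𝓡 n) q)) {F : M → N}
    (hF : ContMDiff (𝓡 n) (𝓡 n) ∞ F) {e : OpenPartialHomeomorph M (EuclideanSpace ℝ (Fin n))}
    (he : e ∈ IsManifold.maximalAtlas (𝓡 n) ∞ M)
    {e' : OpenPartialHomeomorph N (EuclideanSpace ℝ (Fin n))}
    (he' : e' ∈ IsManifold.maximalAtlas (𝓡 n) ∞ N) {y : EuclideanSpace ℝ (Fin n)}
    (hy : y ∈ e.target) (hy' : F (e.symm y) ∈ e'.source) :
    densityCoeff (pullbackFun μ F) e y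
      = |(fderiv ℝ (fun z => e' (F (e.symm z))) y).det|
        * densityCoeff μ e' (e' (F (e.symm y))) := by
  have hd : MDifferentiableAt (𝓡 n) (𝓡 n) e.symm y :=
    (contMDiffAt_symm_of_mem_maximalAtlas he hy).mdifferentiableAt (by simp)
  have hFd : MDifferentiableAt (𝓡 n) (𝓡 n) F (e.symm y) := hF.mdifferentiableAt (by simp)
  have hd' : MDifferentiableAt (𝓡 n) (𝓡 n) e' (F (e.symm y)) :=
    (contMDiffAt_of_mem_maximalAtlas he' hy').mdifferentiableAt (by simp)
  have hd's : MDifferentiableAt (𝓡 n) (𝓡 n) e'.symm (e' (F (e.symm y))) :=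
    (contMDiffAt_symm_of_mem_maximalAtlas he' (e'.map_source hy')).mdifferentiableAt (by simp)
  have hG : MDifferentiableAt (𝓡 n) (𝓡 n) (F ∘ e.symm) y := hFd.comp y hd
  have hJ : MDifferentiableAt (𝓡 n) (𝓡 n) (e' ∘ F ∘ e.symm) y := MDifferentiableAt.comp y hd' hG
  have hev : F ∘ e.symm =ᶠ[𝓝 y] e'.symm ∘ (e' ∘ F ∘ e.symm) := by
    have hc : ContinuousAt (F ∘ e.symm) y := hG.continuousAt
    filter_upwards [hc.preimage_mem_nhds (e'.open_source.mem_nhds hy')] with z hz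
    exact (e'.left_inv hz).symm
  have key : ∀ w : EuclideanSpace ℝ (Fin n),
      mfderiv (𝓡 n) (𝓡 n) F (e.symm y) (mfderiv (𝓡 n) (𝓡 n) e.symm y w)
        = mfderiv (𝓡 n) (𝓡 n) e'.symm (e' (F (e.symm y)))
            (fderiv ℝ (fun z => e' (F (e.symm z))) y w) := by
    intro w
    have h1 := mfderiv_comp_apply y hFd hd w
    have h2 := mfderiv_comp_apply (g := e'.symm) (f := e' ∘ F ∘ e.symm) y hd's hJ w
    rw [← hev.mfderiv_eq] at h2
    rw [mfderiv_eq_fderiv] at h2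
    exact h1.symm.trans h2
  have := finiteDimensional_tangentSpace (n := n) (e'.symm (e' (F (e.symm y))))
  let A : EuclideanSpace ℝ (Fin n) →ₗ[ℝ] TangentSpace (𝓡 n) (e'.symm (e' (F (e.symm y)))) :=
    (mfderiv (𝓡 n) (𝓡 n) e'.symm (e' (F (e.symm y)))).toLinearMap
  let J : EuclideanSpace ℝ (Fin n) →ₗ[ℝ] EuclideanSpace ℝ (Fin n) :=
    (fderiv ℝ (fun z => e' (F (e.symm z))) y).toLinearMap
  have hE : Module.finrank ℝ (EuclideanSpace ℝ (Fin n)) = n := by simp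
  have h3 := (μ (e'.symm (e' (F (e.symm y))))).map_comp_linear hE (finrank_tangentSpace _) A J
    (fun i => EuclideanSpace.single i (1 : ℝ))
  have h4 : ∀ (q : N) (_ : q = F (e.symm y)) (v : Fin n → EuclideanSpace ℝ (Fin n)),
      (μ (F (e.symm y))).toFun v = (μ q).toFun v := by
    rintro q rfl v; rfl
  have h5 : densityCoeff (pullbackFun μ F) e y = (μ (F (e.symm y))).toFun
      (fun i => mfderiv (𝓡 n) (𝓡 n) e'.symm (e' (F (e.symm y)))
            (fderiv ℝ (fun z => e' (F (e.symm z))) y (EuclideanSpace.single i (1 : ℝ)))) :=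
    congrArg (μ (F (e.symm y))).toFun (funext fun i => key _)
  rw [h5]
  exact (h4 _ (e'.left_inv hy') _).trans h3

/-- The pullback `F^* μ` of a density along a smooth map. -/
def pullback [IsManifold (𝓡 n) ∞ M] [IsManifold (𝓡 n) ∞ N] (μ : ManifoldDensity n N) (F : M → N)
    (hF : ContMDiff (𝓡 n) (𝓡 n) ∞ F) : ManifoldDensity n M where
  toFun := pullbackFun μ.toFun F
  continuousOn_coeff' e he := by
    intro y hy
    let e' := chartAt (EuclideanSpace ℝ (Fin n)) (F (e.symm y))
    have he' : e' ∈ IsManifold.maximalAtlas (𝓡 n) ∞ N := IsManifold.chart_mem_maximalAtlas _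
    have hy' : F (e.symm y) ∈ e'.source := mem_chart_source _ _
    have hcF : ContMDiffAt (𝓡 n) (𝓡 n) ∞ (fun z => F (e.symm z)) y :=
      (hF _).comp y (contMDiffAt_symm_of_mem_maximalAtlas he hy)
    have hcJ : ContDiffAt ℝ ∞ (fun z => e' (F (e.symm z))) y :=
      (ContMDiffAt.comp (g := e') y (contMDiffAt_of_mem_maximalAtlas he' hy') hcF).contDiffAt
    have hev : densityCoeff (pullbackFun μ.toFun F) e =ᶠ[𝓝 y] fun z =>
        |(fderiv ℝ (fun z => e' (F (e.symm z))) z).det| * μ.coeff e' (e' (F (e.symm z))) := by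
      filter_upwards [e.open_target.mem_nhds hy,
        hcF.continuousAt.preimage_mem_nhds (e'.open_source.mem_nhds hy')] with z hz hz'
      exact densityCoeff_pullbackFun μ.toFun hF he he' hz hz'
    refine ContinuousAt.continuousWithinAt (ContinuousAt.congr ?_ hev.symm)
    refine ContinuousAt.mul ?_ ?_
    · exact (ContinuousLinearMap.continuous_det.continuousAt.comp
        (hcJ.continuousAt_fderiv (by simp))).abs
    · exact ContinuousAt.comp (f := fun z => e' (F (e.symm z)))
        ((μ.continuousOn_coeff he').continuousAt (e'.open_target.mem_nhds (e'.map_source hy')))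
        hcJ.continuousAt

theorem IsNonneg.pullback [IsManifold (𝓡 n) ∞ M] [IsManifold (𝓡 n) ∞ N] {μ : ManifoldDensity n N}
    (h : μ.IsNonneg) (F : M → N) (hF : ContMDiff (𝓡 n) (𝓡 n) ∞ F) :
    (μ.pullback F hF).IsNonneg :=
  fun p _ => h (F p) _

end pullback

section integral

variable {n : ℕ} {M : Type*} [TopologicalSpace M] [ChartedSpace (EuclideanSpace ℝ (Fin n)) M]

/-- The integral `∫_M μ` of a density with compact support in the domain of the chart `e`: the
Lebesgue integral of its coordinate expression. -/
def chartIntegral (μ : ManifoldDensity n M)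
    (e : OpenPartialHomeomorph M (EuclideanSpace ℝ (Fin n))) : ℝ :=
  ∫ y in e.target, μ.coeff e y

variable [IsManifold (𝓡 n) ∞ M] [T2Space M] [SecondCountableTopology M]

variable (n M) in
theorem exists_chartPartition : ∃ ρ : SmoothPartitionOfUnity M (𝓡 n) M univ,
    ρ.IsSubordinate (fun x => (chartAt (EuclideanSpace ℝ (Fin n)) x).source) :=
  haveI : LocallyCompactSpace M := ChartedSpace.locallyCompactSpace (EuclideanSpace ℝ (Fin n)) M
  SmoothPartitionOfUnity.exists_isSubordinate_chartAt_source (𝓡 n) M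

variable (n M) in
/-- A smooth partition of unity subordinate to the cover of `M` by chart domains. -/
def chartPartition : SmoothPartitionOfUnity M (𝓡 n) M univ := (exists_chartPartition n M).choose

theorem chartPartition_isSubordinate : (chartPartition n M).IsSubordinate
    (fun x => (chartAt (EuclideanSpace ℝ (Fin n)) x).source) :=
  (exists_chartPartition n M).choose_spec

/-- The summand with index `x` of the partition of unity, as a continuous function. -/
def chartBump (x : M) : C(M, ℝ) := ⟨chartPartition n M x, (chartPartition n M x).contMDiff.continuous⟩

/-- The integral `∫_M μ` of a compactly supported density: `μ` is decomposed by a partition of unity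
subordinate to chart domains, and the pieces are integrated in the charts. (By the change of
variables formula the value does not depend on the charts and the partition of unity. When `μ` has
compact support, only finitely many summands are nonzero.) -/
def integral (μ : ManifoldDensity n M) : ℝ :=
  ∑ᶠ x : M, (mulFun (chartBump (n := n) x) μ).chartIntegral (chartAt (EuclideanSpace ℝ (Fin n)) x)

open CompactlySupported

theorem integrableOn_piece (μ : ManifoldDensity n M) (f : C_c(M, ℝ)) (x : M) :
    IntegrableOn ((mulFun (chartBump (n := n) x) (mulFun f.toContinuousMap μ)).coeff
      (chartAt (EuclideanSpace ℝ (Fin n)) x)) (chartAt (EuclideanSpace ℝ (Fin n)) x).target := by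
  set e := chartAt (EuclideanSpace ℝ (Fin n)) x with he
  have hem : e ∈ IsManifold.maximalAtlas (𝓡 n) ∞ M := IsManifold.chart_mem_maximalAtlas _
  let S : Set M := tsupport f ∩ tsupport (chartPartition n M x)
  have hS : IsCompact S := f.hasCompactSupport.inter_right (isClosed_tsupport _)
  have hSe : S ⊆ e.source := fun p hp => chartPartition_isSubordinate x hp.2
  have hK : IsCompact (e '' S) := hS.image_of_continuousOn (e.continuousOn.mono hSe)
  have hKt : e '' S ⊆ e.target := by
    rintro _ ⟨p, hp, rfl⟩; exact e.map_source (hSe hp)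
  refine IntegrableOn.of_forall_sdiff_eq_zero
    ((((continuousOn_coeff _ hem).mono hKt).integrableOn_compact hK)) e.open_target.measurableSet ?_
  rintro y ⟨hy, hyK⟩
  rw [coeff_mulFun, coeff_mulFun]
  by_contra hne
  refine hyK ⟨e.symm y, ⟨subset_tsupport _ ?_, subset_tsupport _ ?_⟩, e.right_inv hy⟩
  · intro h0
    exact hne (by change _ * (f (e.symm y) * _) = 0; rw [h0]; ring)
  · intro h0
    exact hne (by change chartPartition n M x (e.symm y) * _ = 0; rw [h0]; ring)

theorem finite_support_pieces (μ : ManifoldDensity n M) (f : C_c(M, ℝ)) :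
    (support fun x : M => (mulFun (chartBump (n := n) x) (mulFun f.toContinuousMap μ)).chartIntegral
      (chartAt (EuclideanSpace ℝ (Fin n)) x)).Finite := by
  refine ((chartPartition n M).locallyFinite.finite_nonempty_inter_compact
    f.hasCompactSupport).subset ?_
  intro x hx
  by_contra hne
  refine hx (integral_eq_zero_of_ae (Filter.Eventually.of_forall fun y => ?_))
  rw [coeff_mulFun, coeff_mulFun]
  change chartPartition n M x _ * (f _ * _) = 0
  by_contra h0
  refine hne ⟨(chartAt (EuclideanSpace ℝ (Fin n)) x).symm y, fun h1 => h0 ?_, subset_tsupport _ fun h2 => h0 ?_⟩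
  · rw [h1]; ring
  · rw [h2]; ring

/-- The positive linear functional `f ↦ ∫_M f μ` on `C_c(M)` of a nonnegative density `μ`. -/
def functional (μ : ManifoldDensity n M) (hμ : μ.IsNonneg) : C_c(M, ℝ) →ₚ[ℝ] ℝ :=
  PositiveLinearMap.mk₀
    { toFun := fun f => (mulFun f.toContinuousMap μ).integral
      map_add' := by
        intro f g
        unfold integral
        rw [← finsum_add_distrib (finite_support_pieces μ f) (finite_support_pieces μ g)]
        refine finsum_congr fun x => ?_
        unfold chartIntegral
        rw [← integral_add (integrableOn_piece μ f x) (integrableOn_piece μ g x)]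
        refine integral_congr_ae (Filter.Eventually.of_forall fun y => ?_)
        simp only [coeff_mulFun]
        change _ * ((f _ + g _) * _) = _ * (f _ * _) + _ * (g _ * _)
        ring
      map_smul' := by
        intro c f
        unfold integral
        rw [RingHom.id_apply, smul_finsum]
        refine finsum_congr fun x => ?_
        unfold chartIntegral
        rw [smul_eq_mul, ← integral_const_mul]
        refine integral_congr_ae (Filter.Eventually.of_forall fun y => ?_)
        simp only [coeff_mulFun]
        change _ * ((c * f _) * _) = c * (_ * (f _ * _))
        ring }
    (by
      intro f hf
      refine finsum_nonneg fun x => integral_nonneg fun y => ?_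
      rw [coeff_mulFun, coeff_mulFun]
      exact mul_nonneg ((chartPartition n M).nonneg x _) (mul_nonneg (hf _) (hμ _ _)))

/-- The Radon measure induced by a nonnegative density `μ`: the measure that represents the
functional `f ↦ ∫_M f μ` on `C_c(M)`. -/
def inducedMeasure [MeasurableSpace M] [BorelSpace M] (μ : ManifoldDensity n M) (hμ : μ.IsNonneg) :
    Measure M :=
  haveI : LocallyCompactSpace M := ChartedSpace.locallyCompactSpace (EuclideanSpace ℝ (Fin n)) M
  RealRMK.rieszMeasure (μ.functional hμ)

end integral

end ManifoldDensity

end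

/-!
For a density with coefficient `g` in a smooth chart `e`, a function `f` with compact support in the
domain of `e` has integral `∫ f(e⁻¹ y) g(y) dy` over `M`, whichever such chart is taken: under a
change of charts the coefficient is multiplied by the absolute value of the Jacobian determinant
(`coeff_eq_abs_det_mul_coeff`), which is the factor in the change of variables formula
(`setIntegral_coeff_eq`). Summing over the partition of unity in the definition of the integral
gives `integral_inducedMeasure_eq_setIntegral`. By a partition of unity again, a regular measure is
determined by its integrals of such functions
(`measure_ext_of_integral_eq_of_tsupport_subset_chart`), so identities between induced measures are
identities between coefficients in charts.

For the pushforward, a chart `e` of `N` gives the chart `e ∘ F` of `M`; the coefficient of `μ` in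
`e ∘ F` is the coefficient of `(F⁻¹)^* μ` in `e`, by the chain rule (`coeff_pullback_symm`), and
`map_inducedMeasure` follows. For the function `f`, the densities on a vector space form a space of
dimension at most one, so `(F⁻¹)^* μ_M = f μ_N`, where `f` is in every chart the quotient of the two
coefficients; it is smooth because the coefficient of `μ_N` is smooth and does not vanish
(`contMDiff_quotient`). Absolute continuity is a consequence.
-/

open scoped CompactlySupported

/-! ### Densities on vector spaces -/

namespace VectorDensity

/-- The ratio of two densities is the same on every tuple: the space of densities on `V` is at most
one-dimensional. -/
theorem mul_basis_eq {n : ℕ} {V : Type*} [AddCommGroup V] [Module ℝ V] (δ δ' : VectorDensity n V)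
    (b : Module.Basis (Fin n) ℝ V) (v : Fin n → V) : δ v * δ' b = δ b * δ' v := by
  have h := δ.map_linear' (b.constr ℝ v) b
  have h' := δ'.map_linear' (b.constr ℝ v) b
  simp only [b.constr_basis] at h h'
  rw [h, h']
  ring

end VectorDensity

namespace ManifoldDensity

/-! ### Coordinate expressions -/

section coeff

variable {n : ℕ} {M N : Type*}
  [TopologicalSpace M] [ChartedSpace (EuclideanSpace ℝ (Fin n)) M]
  [TopologicalSpace N] [ChartedSpace (EuclideanSpace ℝ (Fin n)) N]

theorem pullbackFun_id (μ : ∀ p : M, VectorDensity n (TangentSpace (𝓡 n) p)) :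
    pullbackFun μ id = μ := by
  funext p
  have h : (pullbackFun μ id p).toFun = (μ p).toFun := by
    funext v
    simp [pullbackFun, mfderiv_id]
  cases h' : pullbackFun μ id p
  cases h'' : μ p
  rw [h', h''] at h
  congr

/-- A change of chart multiplies the coordinate expression by the absolute value of the Jacobian
determinant of the transition map. -/
theorem coeff_eq_abs_det_mul_coeff [IsManifold (𝓡 n) ∞ M] (μ : ManifoldDensity n M)
    {e e' : OpenPartialHomeomorph M (EuclideanSpace ℝ (Fin n))}
    (he : e ∈ IsManifold.maximalAtlas (𝓡 n) ∞ M) (he' : e' ∈ IsManifold.maximalAtlas (𝓡 n) ∞ M)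
    {y : EuclideanSpace ℝ (Fin n)} (hy : y ∈ e.target) (hy' : e.symm y ∈ e'.source) :
    μ.coeff e y = |(fderiv ℝ (fun z => e' (e.symm z)) y).det| * μ.coeff e' (e' (e.symm y)) := by
  have h := densityCoeff_pullbackFun μ.toFun contMDiff_id he he' hy hy'
  rwa [pullbackFun_id] at h

/-- The coordinate frame of a smooth chart is linearly independent. -/
theorem linearIndependent_coordFrame [IsManifold (𝓡 n) ∞ M]
    {e : OpenPartialHomeomorph M (EuclideanSpace ℝ (Fin n))}
    (he : e ∈ IsManifold.maximalAtlas (𝓡 n) ∞ M) {y : EuclideanSpace ℝ (Fin n)}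
    (hy : y ∈ e.target) :
    LinearIndependent ℝ (fun i : Fin n => (mfderiv (𝓡 n) (𝓡 n) e.symm y
      (EuclideanSpace.single i (1 : ℝ)) : TangentSpace (𝓡 n) (e.symm y))) := by
  have hd : MDifferentiableAt (𝓡 n) (𝓡 n) e.symm y :=
    (contMDiffAt_symm_of_mem_maximalAtlas he hy).mdifferentiableAt (by simp)
  have hd' : MDifferentiableAt (𝓡 n) (𝓡 n) e (e.symm y) :=
    (contMDiffAt_of_mem_maximalAtlas he (e.map_target hy)).mdifferentiableAt (by simp)
  have hev : e ∘ e.symm =ᶠ[𝓝 y] id := by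
    filter_upwards [e.open_target.mem_nhds hy] with z hz using e.right_inv hz
  have hinv : ∀ w : EuclideanSpace ℝ (Fin n),
      mfderiv (𝓡 n) (𝓡 n) e (e.symm y) (mfderiv (𝓡 n) (𝓡 n) e.symm y w) = w := by
    intro w
    have h := mfderiv_comp_apply y hd' hd w
    rw [hev.mfderiv_eq, mfderiv_id] at h
    exact h.symm
  refine LinearIndependent.of_comp (mfderiv (𝓡 n) (𝓡 n) e (e.symm y)).toLinearMap ?_
  have hb := (EuclideanSpace.basisFun (Fin n) ℝ).toBasis.linearIndependent
  have hframe : ⇑(EuclideanSpace.basisFun (Fin n) ℝ).toBasis = fun i : Fin n =>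
      mfderiv (𝓡 n) (𝓡 n) e (e.symm y)
        (mfderiv (𝓡 n) (𝓡 n) e.symm y (EuclideanSpace.single i (1 : ℝ))) :=
    funext fun i => by
      rw [hinv, OrthonormalBasis.coe_toBasis, EuclideanSpace.basisFun_apply]
  rw [hframe] at hb
  exact hb

theorem coeff_pos [IsManifold (𝓡 n) ∞ M] {μ : ManifoldDensity n M} (h : μ.IsPositive)
    {e : OpenPartialHomeomorph M (EuclideanSpace ℝ (Fin n))}
    (he : e ∈ IsManifold.maximalAtlas (𝓡 n) ∞ M) {y : EuclideanSpace ℝ (Fin n)}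
    (hy : y ∈ e.target) : 0 < μ.coeff e y :=
  h _ _ (linearIndependent_coordFrame he hy)

/-- Composition with a diffeomorphism turns smooth charts into smooth charts. -/
theorem _root_.Diffeomorph.trans_mem_maximalAtlas [IsManifold (𝓡 n) ∞ M] (F : M ≃ₘ⟮𝓡 n, 𝓡 n⟯ N)
    {e : OpenPartialHomeomorph N (EuclideanSpace ℝ (Fin n))}
    (he : e ∈ IsManifold.maximalAtlas (𝓡 n) ∞ N) :
    F.toHomeomorph.transOpenPartialHomeomorph e ∈ IsManifold.maximalAtlas (𝓡 n) ∞ M := by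
  refine OpenPartialHomeomorph.mem_maximalAtlas_of_contMDiffOn _ ?_ ?_
  · exact (contMDiffOn_of_mem_maximalAtlas he).comp F.contMDiff.contMDiffOn fun _ hx => hx
  · exact F.symm.contMDiff.comp_contMDiffOn (contMDiffOn_symm_of_mem_maximalAtlas he)

/-- In corresponding charts, a density and its pullback along the inverse of a diffeomorphism have
the same coordinate expression. -/
theorem coeff_pullback_symm [IsManifold (𝓡 n) ∞ M] [IsManifold (𝓡 n) ∞ N]
    (μ : ManifoldDensity n M) (F : M ≃ₘ⟮𝓡 n, 𝓡 n⟯ N)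
    {e : OpenPartialHomeomorph N (EuclideanSpace ℝ (Fin n))}
    (he : e ∈ IsManifold.maximalAtlas (𝓡 n) ∞ N) {y : EuclideanSpace ℝ (Fin n)}
    (hy : y ∈ e.target) :
    (μ.pullback F.symm F.symm.contMDiff).coeff e y
      = μ.coeff (F.toHomeomorph.transOpenPartialHomeomorph e) y := by
  have hd : MDifferentiableAt (𝓡 n) (𝓡 n) e.symm y :=
    (contMDiffAt_symm_of_mem_maximalAtlas he hy).mdifferentiableAt (by simp)
  have hF : MDifferentiableAt (𝓡 n) (𝓡 n) F.symm (e.symm y) :=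
    F.symm.contMDiff.mdifferentiableAt (by simp)
  exact congrArg (μ.toFun (F.symm (e.symm y))).toFun
    (funext fun i => (mfderiv_comp_apply y hF hd (EuclideanSpace.single i (1 : ℝ))).symm)

theorem IsSmooth.pullback_symm [IsManifold (𝓡 n) ∞ M] [IsManifold (𝓡 n) ∞ N]
    {μ : ManifoldDensity n M} (h : μ.IsSmooth) (F : M ≃ₘ⟮𝓡 n, 𝓡 n⟯ N) :
    (μ.pullback F.symm F.symm.contMDiff).IsSmooth := fun _ he =>
  (h _ (F.trans_mem_maximalAtlas he)).congr fun _ hy => μ.coeff_pullback_symm F he hy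

/-! ### The quotient of two densities -/

/-- The standard basis of the model space `ℝⁿ`, as a basis of the tangent space at `p`. It need not
depend continuously on `p`. -/
noncomputable def tangentBasis (p : M) : Module.Basis (Fin n) ℝ (TangentSpace (𝓡 n) p) :=
  (EuclideanSpace.basisFun (Fin n) ℝ).toBasis

/-- The quotient `ν / μ` of two densities: the quotient of their values on a basis of each tangent
space. Where `μ` is positive, it does not depend on the basis. -/
noncomputable def quotient (ν μ : ManifoldDensity n M) (p : M) : ℝ :=
  ν.toFun p (tangentBasis p) / μ.toFun p (tangentBasis p)

theorem quotient_nonneg {ν μ : ManifoldDensity n M} (hν : ν.IsNonneg) (hμ : μ.IsNonneg) (p : M) :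
    0 ≤ quotient ν μ p :=
  div_nonneg (hν _ _) (hμ _ _)

theorem coeff_eq_quotient_mul_coeff (ν : ManifoldDensity n M) {μ : ManifoldDensity n M}
    (hμ : μ.IsPositive) (e : OpenPartialHomeomorph M (EuclideanSpace ℝ (Fin n)))
    (y : EuclideanSpace ℝ (Fin n)) :
    ν.coeff e y = quotient ν μ (e.symm y) * μ.coeff e y := by
  have hpos := hμ (e.symm y) _ (tangentBasis (n := n) (e.symm y)).linearIndependent
  rw [quotient, div_mul_eq_mul_div, eq_div_iff hpos.ne']
  exact (ν.toFun (e.symm y)).mul_basis_eq (μ.toFun (e.symm y)) (tangentBasis _) _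

theorem contMDiff_quotient [IsManifold (𝓡 n) ∞ M] {ν μ : ManifoldDensity n M}
    (hν : ν.IsSmooth) (hμ : μ.IsSmooth) (hμ0 : μ.IsPositive) :
    ContMDiff (𝓡 n) 𝓘(ℝ, ℝ) ∞ (quotient ν μ) := by
  intro p
  let e := chartAt (EuclideanSpace ℝ (Fin n)) p
  have he : e ∈ IsManifold.maximalAtlas (𝓡 n) ∞ M := IsManifold.chart_mem_maximalAtlas _
  have hp : p ∈ e.source := mem_chart_source _ p
  have hq : ContDiffOn ℝ ∞ (fun y => ν.coeff e y / μ.coeff e y) e.target :=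
    (hν e he).div (hμ e he) fun y hy => (coeff_pos hμ0 he hy).ne'
  have hqp : ContMDiffAt (𝓡 n) 𝓘(ℝ, ℝ) ∞ (fun y => ν.coeff e y / μ.coeff e y) (e p) :=
    (hq.contDiffAt (e.open_target.mem_nhds (e.map_source hp))).contMDiffAt
  refine (hqp.comp p (contMDiffAt_of_mem_maximalAtlas he hp)).congr_of_eventuallyEq ?_
  filter_upwards [e.open_source.mem_nhds hp] with q hq
  have h := coeff_eq_quotient_mul_coeff ν hμ0 e (e q)
  rw [e.left_inv hq] at h
  exact (eq_div_iff (coeff_pos hμ0 he (e.map_source hq)).ne').2 h.symm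

end coeff

/-! ### The induced measure in a chart -/

section inducedMeasure

variable {n : ℕ} {M : Type*} [TopologicalSpace M] [ChartedSpace (EuclideanSpace ℝ (Fin n)) M]

/-- The integral over a chart of a function supported in two chart domains does not depend on the
chart: this is the change of variables formula. -/
theorem setIntegral_coeff_eq [IsManifold (𝓡 n) ∞ M] (μ : ManifoldDensity n M)
    {e e' : OpenPartialHomeomorph M (EuclideanSpace ℝ (Fin n))}
    (he : e ∈ IsManifold.maximalAtlas (𝓡 n) ∞ M) (he' : e' ∈ IsManifold.maximalAtlas (𝓡 n) ∞ M)
    {g : M → ℝ} (hg : support g ⊆ e.source) (hg' : support g ⊆ e'.source) :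
    ∫ y in e.target, g (e.symm y) * μ.coeff e y
      = ∫ y in e'.target, g (e'.symm y) * μ.coeff e' y := by
  let φ := e.symm.trans e'
  have hsource : φ.source = e.target ∩ e.symm ⁻¹' e'.source :=
    OpenPartialHomeomorph.trans_source ..
  have htarget : φ.target = e'.target ∩ e'.symm ⁻¹' e.source :=
    OpenPartialHomeomorph.trans_target ..
  have hφs : φ.source ⊆ e.target := hsource ▸ inter_subset_left
  have hφs' : ∀ y ∈ φ.source, e.symm y ∈ e'.source := fun y hy => (hsource ▸ hy).2
  have h1 : ∫ y in e.target, g (e.symm y) * μ.coeff e y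
      = ∫ y in φ.source, g (e.symm y) * μ.coeff e y := by
    refine setIntegral_eq_of_subset_of_forall_sdiff_eq_zero e.open_target.measurableSet hφs ?_
    rintro y ⟨hy, hyφ⟩
    by_contra h0
    exact hyφ (hsource ▸ ⟨hy, hg' (left_ne_zero_of_mul h0)⟩)
  have h2 : ∫ y in e'.target, g (e'.symm y) * μ.coeff e' y
      = ∫ y in φ.target, g (e'.symm y) * μ.coeff e' y := by
    refine setIntegral_eq_of_subset_of_forall_sdiff_eq_zero e'.open_target.measurableSet
      (htarget ▸ inter_subset_left) ?_
    rintro y ⟨hy, hyφ⟩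
    by_contra h0
    exact hyφ (htarget ▸ ⟨hy, hg (left_ne_zero_of_mul h0)⟩)
  have hder : ∀ y ∈ φ.source, HasFDerivWithinAt φ (fderiv ℝ φ y) φ.source y := by
    intro y hy
    have hc : ContMDiffAt (𝓡 n) (𝓡 n) ∞ φ y :=
      (contMDiffAt_of_mem_maximalAtlas he' (hφs' y hy)).comp y
        (contMDiffAt_symm_of_mem_maximalAtlas he (hφs hy))
    exact (hc.contDiffAt.differentiableAt (by simp)).hasFDerivAt.hasFDerivWithinAt
  rw [h1, h2, ← φ.image_source_eq_target, integral_image_eq_integral_abs_det_fderiv_smul volume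
    φ.open_source.measurableSet hder φ.injOn]
  refine setIntegral_congr_fun φ.open_source.measurableSet fun y hy => ?_
  have hφy : e'.symm (φ y) = e.symm y := e'.left_inv (hφs' y hy)
  simp only [smul_eq_mul]
  rw [hφy, μ.coeff_eq_abs_det_mul_coeff he he' (hφs hy) (hφs' y hy)]
  change _ = |(fderiv ℝ (fun z => e' (e.symm z)) y).det| * (_ * μ.coeff e' (e' (e.symm y)))
  ring

theorem integrableOn_coeff (μ : ManifoldDensity n M)
    {e : OpenPartialHomeomorph M (EuclideanSpace ℝ (Fin n))}
    (he : e ∈ IsManifold.maximalAtlas (𝓡 n) ∞ M) (f : C_c(M, ℝ)) (hf : tsupport f ⊆ e.source) :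
    IntegrableOn (fun y => f (e.symm y) * μ.coeff e y) e.target := by
  have hK : IsCompact (e '' tsupport f) :=
    f.hasCompactSupport.isCompact.image_of_continuousOn (e.continuousOn.mono hf)
  have hKt : e '' tsupport f ⊆ e.target := by
    rintro _ ⟨p, hp, rfl⟩
    exact e.map_source (hf hp)
  have hc : ContinuousOn (fun y => f (e.symm y) * μ.coeff e y) e.target :=
    (f.continuous.comp_continuousOn e.continuousOn_symm).mul (μ.continuousOn_coeff he)
  refine IntegrableOn.of_forall_sdiff_eq_zero ((hc.mono hKt).integrableOn_compact hK)
    e.open_target.measurableSet ?_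
  rintro y ⟨hy, hyK⟩
  by_contra h0
  exact hyK ⟨e.symm y, subset_tsupport _ (left_ne_zero_of_mul h0), e.right_inv hy⟩

variable [IsManifold (𝓡 n) ∞ M] [T2Space M] [SecondCountableTopology M]

/-- Only finitely many members of the partition of unity do not vanish identically on the support
of `f`, and they add up to `1` there. -/
theorem exists_finset_chartPartition_sum (f : C_c(M, ℝ)) : ∃ S : Finset M,
    (∀ p, f p = ∑ x ∈ S, chartPartition n M x p * f p) ∧
      ∀ x ∉ S, ∀ p, chartPartition n M x p * f p = 0 := by
  have hfin := (chartPartition n M).locallyFinite.finite_nonempty_inter_compact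
    f.hasCompactSupport
  have hmem : ∀ x p, chartPartition n M x p ≠ 0 → f p ≠ 0 → x ∈ hfin.toFinset := fun x p h h' =>
    hfin.mem_toFinset.2 ⟨p, h, subset_tsupport _ h'⟩
  refine ⟨hfin.toFinset, fun p => ?_, fun x hx p => ?_⟩
  · by_cases hp : f p = 0
    · simp [hp]
    · rw [← Finset.sum_mul, (chartPartition n M).sum_finsupport' p (mem_univ p), one_mul]
      exact fun x hx => hmem x p (((chartPartition n M).mem_finsupport p).1 hx) hp
  · by_contra h0
    exact hx (hmem x p (left_ne_zero_of_mul h0) (right_ne_zero_of_mul h0))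

/-- The product of a member of the partition of unity and a compactly supported function. -/
noncomputable def chartPiece (x : M) (f : C_c(M, ℝ)) : C_c(M, ℝ) where
  toContinuousMap := chartBump (n := n) x * f.toContinuousMap
  hasCompactSupport' := f.hasCompactSupport.mul_left

theorem chartPiece_apply (x : M) (f : C_c(M, ℝ)) (p : M) :
    chartPiece (n := n) x f p = chartPartition n M x p * f p := rfl

theorem tsupport_chartPiece_subset (x : M) (f : C_c(M, ℝ)) :
    tsupport (chartPiece (n := n) x f) ⊆ tsupport f :=
  tsupport_mul_subset_right

theorem tsupport_chartPiece_subset_source (x : M) (f : C_c(M, ℝ)) :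
    tsupport (chartPiece (n := n) x f) ⊆ (chartAt (EuclideanSpace ℝ (Fin n)) x).source :=
  tsupport_mul_subset_left.trans (chartPartition_isSubordinate x)

/-- The functional `f ↦ ∫_M f μ` can be computed in any smooth chart whose domain contains the
support of `f`. -/
theorem functional_eq_setIntegral (μ : ManifoldDensity n M) (hμ : μ.IsNonneg)
    {e : OpenPartialHomeomorph M (EuclideanSpace ℝ (Fin n))}
    (he : e ∈ IsManifold.maximalAtlas (𝓡 n) ∞ M) (f : C_c(M, ℝ)) (hf : tsupport f ⊆ e.source) :
    μ.functional hμ f = ∫ y in e.target, f (e.symm y) * μ.coeff e y := by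
  obtain ⟨S, hS, hS0⟩ := exists_finset_chartPartition_sum (n := n) f
  have hpiece : ∀ x : M,
      (mulFun (chartBump (n := n) x) (mulFun f.toContinuousMap μ)).chartIntegral
          (chartAt (EuclideanSpace ℝ (Fin n)) x)
        = ∫ y in e.target, chartPiece (n := n) x f (e.symm y) * μ.coeff e y := by
    intro x
    rw [← setIntegral_coeff_eq μ (IsManifold.chart_mem_maximalAtlas x) he
      ((subset_tsupport _).trans (tsupport_chartPiece_subset_source x f))
      ((subset_tsupport _).trans ((tsupport_chartPiece_subset x f).trans hf))]
    refine integral_congr_ae (Filter.Eventually.of_forall fun y => ?_)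
    simp only [coeff_mulFun, chartPiece_apply, mul_assoc]
    rfl
  calc μ.functional hμ f
      = ∑ᶠ x : M, ∫ y in e.target, chartPiece (n := n) x f (e.symm y) * μ.coeff e y :=
        finsum_congr hpiece
    _ = ∑ x ∈ S, ∫ y in e.target, chartPiece (n := n) x f (e.symm y) * μ.coeff e y := by
        refine finsum_eq_sum_of_support_subset _ fun x hx => ?_
        by_contra hxS
        exact hx (by simp [chartPiece_apply, hS0 x hxS])
    _ = ∫ y in e.target, ∑ x ∈ S, chartPiece (n := n) x f (e.symm y) * μ.coeff e y :=
        (integral_finsetSum S fun x _ => integrableOn_coeff μ he _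
          ((tsupport_chartPiece_subset x f).trans hf)).symm
    _ = ∫ y in e.target, f (e.symm y) * μ.coeff e y := by
        refine integral_congr_ae (Filter.Eventually.of_forall fun y => ?_)
        simp only [chartPiece_apply]
        rw [← Finset.sum_mul, ← hS]

variable [MeasurableSpace M] [BorelSpace M]

instance regular_inducedMeasure (μ : ManifoldDensity n M) (hμ : μ.IsNonneg) :
    (μ.inducedMeasure hμ).Regular :=
  have : LocallyCompactSpace M := ChartedSpace.locallyCompactSpace (EuclideanSpace ℝ (Fin n)) M
  RealRMK.regular_rieszMeasure _

theorem integral_inducedMeasure_eq_setIntegral (μ : ManifoldDensity n M) (hμ : μ.IsNonneg)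
    {e : OpenPartialHomeomorph M (EuclideanSpace ℝ (Fin n))}
    (he : e ∈ IsManifold.maximalAtlas (𝓡 n) ∞ M) (f : C_c(M, ℝ)) (hf : tsupport f ⊆ e.source) :
    ∫ p, f p ∂μ.inducedMeasure hμ = ∫ y in e.target, f (e.symm y) * μ.coeff e y := by
  have : LocallyCompactSpace M := ChartedSpace.locallyCompactSpace (EuclideanSpace ℝ (Fin n)) M
  rw [← functional_eq_setIntegral μ hμ he f hf]
  exact RealRMK.integral_rieszMeasure _ f

/-- Two regular measures on a manifold agree if they give the same integral to every continuous
function with compact support in the domain of a smooth chart. -/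
theorem measure_ext_of_integral_eq_of_tsupport_subset_chart {m m' : Measure M} [m.Regular]
    [m'.Regular] (h : ∀ e ∈ IsManifold.maximalAtlas (𝓡 n) ∞ M, ∀ f : C_c(M, ℝ),
      tsupport f ⊆ e.source → ∫ p, f p ∂m = ∫ p, f p ∂m') : m = m' := by
  have : LocallyCompactSpace M := ChartedSpace.locallyCompactSpace (EuclideanSpace ℝ (Fin n)) M
  refine Measure.ext_of_integral_eq_on_compactlySupported fun f => ?_
  obtain ⟨S, hS, -⟩ := exists_finset_chartPartition_sum (n := n) f
  have hsum : ∀ (k : Measure M) [k.Regular],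
      ∫ p, f p ∂k = ∑ x ∈ S, ∫ p, chartPiece (n := n) x f p ∂k := by
    intro k _
    rw [← integral_finsetSum S fun x _ => (chartPiece (n := n) x f).integrable]
    exact integral_congr_ae (Filter.Eventually.of_forall hS)
  rw [hsum m, hsum m']
  exact Finset.sum_congr rfl fun x _ => h _ (IsManifold.chart_mem_maximalAtlas x) _
    (tsupport_chartPiece_subset_source x f)

/-! ### Pushforward and Radon–Nikodym derivative -/

/-- If the coordinate expressions satisfy `ν = h μ`, then the induced measure of `ν` has density
`h` with respect to that of `μ`. -/
theorem inducedMeasure_eq_withDensity {ν μ : ManifoldDensity n M} (hν : ν.IsNonneg)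
    (hμ : μ.IsNonneg) {h : M → ℝ} (hc : Continuous h) (h0 : ∀ p, 0 ≤ h p)
    (hνμ : ∀ (e : OpenPartialHomeomorph M (EuclideanSpace ℝ (Fin n))) (y),
      ν.coeff e y = h (e.symm y) * μ.coeff e y) :
    ν.inducedMeasure hν
      = (μ.inducedMeasure hμ).withDensity (fun p => ENNReal.ofReal (h p)) := by
  have : LocallyCompactSpace M := ChartedSpace.locallyCompactSpace (EuclideanSpace ℝ (Fin n)) M
  have := TopologicalSpace.metrizableSpace_of_t3_secondCountable M
  have := IsLocallyFiniteMeasure.withDensity_ofReal (μ := μ.inducedMeasure hμ) hc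
  refine measure_ext_of_integral_eq_of_tsupport_subset_chart (n := n) fun e he f hf => ?_
  rw [integral_withDensity_eq_integral_toReal_smul hc.measurable.ennreal_ofReal
    (Filter.Eventually.of_forall fun _ => ENNReal.ofReal_lt_top)]
  let hf' : C_c(M, ℝ) := ⟨⟨h, hc⟩ * f.toContinuousMap, f.hasCompactSupport.mul_left⟩
  have hint : ∫ p, (ENNReal.ofReal (h p)).toReal • f p ∂μ.inducedMeasure hμ
      = ∫ p, hf' p ∂μ.inducedMeasure hμ := by
    refine integral_congr_ae (Filter.Eventually.of_forall fun p => ?_)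
    simp only [ENNReal.toReal_ofReal (h0 p), smul_eq_mul]
    rfl
  rw [hint, integral_inducedMeasure_eq_setIntegral ν hν he f hf,
    integral_inducedMeasure_eq_setIntegral μ hμ he hf' (tsupport_mul_subset_right.trans hf)]
  refine integral_congr_ae (Filter.Eventually.of_forall fun y => ?_)
  change f (e.symm y) * ν.coeff e y = h (e.symm y) * f (e.symm y) * μ.coeff e y
  rw [hνμ]
  ring

/-- A diffeomorphism carries the measure of a density to the measure of the pullback of the density
along the inverse. -/
theorem map_inducedMeasure {N : Type*} [TopologicalSpace N]
    [ChartedSpace (EuclideanSpace ℝ (Fin n)) N] [IsManifold (𝓡 n) ∞ N] [T2Space N]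
    [SecondCountableTopology N] [MeasurableSpace N] [BorelSpace N]
    (μ : ManifoldDensity n M) (hμ : μ.IsNonneg) (F : M ≃ₘ⟮𝓡 n, 𝓡 n⟯ N) :
    Measure.map F (μ.inducedMeasure hμ)
      = (μ.pullback F.symm F.symm.contMDiff).inducedMeasure
          (hμ.pullback F.symm F.symm.contMDiff) := by
  have : (Measure.map F (μ.inducedMeasure hμ)).Regular := Measure.Regular.map F.toHomeomorph
  refine measure_ext_of_integral_eq_of_tsupport_subset_chart (n := n) fun e he f hf => ?_
  let fF : C_c(M, ℝ) := ⟨⟨f ∘ F, f.continuous.comp F.continuous⟩,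
    f.hasCompactSupport.comp_homeomorph F.toHomeomorph⟩
  have hfF : tsupport fF ⊆ (F.toHomeomorph.transOpenPartialHomeomorph e).source := fun p hp =>
    hf (tsupport_comp_subset_preimage f F.continuous hp)
  rw [integral_inducedMeasure_eq_setIntegral _ _ he f hf]
  refine (F.toHomeomorph.measurableEmbedding.integral_map f).trans ?_
  refine (integral_inducedMeasure_eq_setIntegral μ hμ (F.trans_mem_maximalAtlas he) fF hfF).trans ?_
  refine setIntegral_congr_fun e.open_target.measurableSet fun y hy => ?_
  simp only [μ.coeff_pullback_symm F he hy]
  change f (F (F.symm (e.symm y))) * _ = _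
  rw [F.apply_symm_apply]

end inducedMeasure

end ManifoldDensity

theorem mainTheorem1 {n : ℕ} {M N : Type*}
    [TopologicalSpace M] [ChartedSpace (EuclideanSpace ℝ (Fin n)) M] [IsManifold (𝓡 n) ∞ M]
    [T2Space M] [SecondCountableTopology M] [MeasurableSpace M] [BorelSpace M]
    [TopologicalSpace N] [ChartedSpace (EuclideanSpace ℝ (Fin n)) N] [IsManifold (𝓡 n) ∞ N]
    [T2Space N] [SecondCountableTopology N] [MeasurableSpace N] [BorelSpace N]
    (μM : ManifoldDensity n M) (hμM : μM.IsSmooth) (hμM0 : μM.IsNonneg)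
    (μN : ManifoldDensity n N) (hμN : μN.IsSmooth) (hμN0 : μN.IsPositive)
    (F : M ≃ₘ⟮𝓡 n, 𝓡 n⟯ N) :
    Measure.map F (μM.inducedMeasure hμM0)
        = (μM.pullback F.symm F.symm.contMDiff).inducedMeasure
            (hμM0.pullback F.symm F.symm.contMDiff) ∧
      Measure.map F (μM.inducedMeasure hμM0) ≪ μN.inducedMeasure hμN0.isNonneg ∧
      ∃ f : N → ℝ, ContMDiff (𝓡 n) 𝓘(ℝ, ℝ) ∞ f ∧ (∀ q, 0 ≤ f q) ∧
        Measure.map F (μM.inducedMeasure hμM0)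
          = (μN.inducedMeasure hμN0.isNonneg).withDensity (fun q => ENNReal.ofReal (f q)) := by
  have hmap := ManifoldDensity.map_inducedMeasure μM hμM0 F
  have hν0 := hμM0.pullback F.symm F.symm.contMDiff
  have hsm := ManifoldDensity.contMDiff_quotient (hμM.pullback_symm F) hμN hμN0
  have hq0 := ManifoldDensity.quotient_nonneg hν0 hμN0.isNonneg
  have hdens := hmap.trans (ManifoldDensity.inducedMeasure_eq_withDensity hν0 hμN0.isNonneg
    hsm.continuous hq0 (ManifoldDensity.coeff_eq_quotient_mul_coeff _ hμN0))
  refine ⟨hmap, ?_, _, hsm, hq0, hdens⟩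
  rw [hdens]
  exact withDensity_absolutelyContinuous _ _
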